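/- A combinatorial pseudo-triangulation is a combinatorial embedding in the plane (with a designated outer face) of a finite connected planar simple graph, together with an assignment of tags "reflex" or "convex" to its angles, such that (1) every interior face has exactly three angles tagged convex, (2) all the angles of the outer face are tagged reflex, and (3) no vertex is incident to more than one angle tagged reflex. A combinatorial 4-PPT is a combinatorial pseudo-triangulation in which every vertex is pointed, i.e. incident to (exactly) one angle tagged reflex, and in which every interior face has degree at most $4$. Lemma. Let $T$ be a combinatorial 4-PPT and let $H$ be a subgraph of $T$ (not necessarily induced, spanning or connected) with $|V(H)|\ge 3$. Then $H$ has at least $3$ vertices whose reflex angle in $T$ is contained in the outer face of $H$, where the outer face of $H$ is the unbounded face of the embedding of $H$ inherited from $T$. -/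

import Mathlib

/-- A combinatorial embedding of a simple graph: for every vertex, a cyclic (say, clockwise) order
of the darts leaving it, given by the permutation `rot` sending a dart to the next one around its
source vertex. -/
structure CombinatorialEmbedding {V : Type*} (G : SimpleGraph V) where
  rot : Equiv.Perm G.Dart
  rot_fst : ∀ d, (rot d).fst = d.fst
  sameCycle : ∀ d d' : G.Dart, d.fst = d'.fst → rot.SameCycle d d'

namespace CombinatorialEmbedding

variable {V : Type*} {G : SimpleGraph V} (M : CombinatorialEmbedding G)

/-- The permutation sending a dart `u → v` to the next dart `v → w` on the boundary of the face
lying on a fixed side of it. -/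
def facePerm : Equiv.Perm G.Dart :=
  (Function.Involutive.toPerm SimpleGraph.Dart.symm SimpleGraph.Dart.symm_involutive).trans M.rot

/-- The faces: the orbits of the face permutation. -/
def Face : Type _ := Quotient (Equiv.Perm.SameCycle.setoid M.facePerm)

/-- The face on whose boundary walk the dart `d` lies. The other face at the edge of `d` is
`M.faceOf d.symm`.

The angles of the embedding are in bijection with the darts: the angle of `d` is the one at the
vertex `d.fst` between the consecutive darts `M.rot⁻¹ d` and `d`. It lies in `M.faceOf d`, between
`d` and the dart preceding `d` on the boundary walk of that face. -/
def faceOf (d : G.Dart) : M.Face := Quotient.mk _ d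

/-- A combinatorial embedding of a connected graph with at least one edge is an embedding in the
sphere (equivalently, after the choice of an outer face, in the plane) when its genus is zero. -/
def IsPlanar : Prop := Nat.card V + Nat.card M.Face = Nat.card G.edgeSet + 2

end CombinatorialEmbedding

/-- A combinatorial pseudo-triangulation with vertex set `V`: a combinatorial embedding in the plane
of a connected planar simple graph, with a designated outer face, together with an assignment of
tags reflex/convex to its angles. Angles are represented by darts, see
`CombinatorialEmbedding.faceOf`; those not in the set `reflex` are tagged convex. -/
structure CombinatorialPseudoTriangulation (V : Type*) where
  graph : SimpleGraph V
  connected : graph.Connected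
  embedding : CombinatorialEmbedding graph
  planar : embedding.IsPlanar
  outer : embedding.Face
  reflex : Set graph.Dart
  /-- every interior face has exactly three angles tagged convex -/
  three_convex : ∀ f, f ≠ outer → {d | embedding.faceOf d = f ∧ d ∉ reflex}.ncard = 3
  /-- all the angles of the outer face are tagged reflex -/
  outer_reflex : ∀ d, embedding.faceOf d = outer → d ∈ reflex
  /-- no vertex is incident to more than one reflex angle -/
  reflex_unique : ∀ d ∈ reflex, ∀ d' ∈ reflex, d.fst = d'.fst → d = d'

namespace CombinatorialPseudoTriangulation

variable {V : Type*} (T : CombinatorialPseudoTriangulation V)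

/-- A vertex is pointed if it is incident to an angle tagged reflex. -/
def IsPointedAt (v : V) : Prop := ∃ d ∈ T.reflex, d.fst = v

/-- Combinatorial 4-PPTs: every vertex is pointed and every interior face has degree at most 4. -/
structure IsFourPPT : Prop where
  pointed : ∀ v, T.IsPointedAt v
  degree_le : ∀ f, f ≠ T.outer → {d | T.embedding.faceOf d = f}.ncard ≤ 4

/-- Two faces of `T` are on the two sides of an edge of `T` that is not an edge of `H`. -/
def FaceAdjOff (H : T.graph.Subgraph) (f g : T.embedding.Face) : Prop :=
  ∃ d : T.graph.Dart, d.edge ∉ H.edgeSet ∧ T.embedding.faceOf d = f ∧ T.embedding.faceOf d.symm = g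

/-- The outer face of a (possibly disconnected) subgraph `H`, as the set of those faces of `T` that
are contained in it: removing the edges and vertices that are not in `H` merges faces of `T`, and
the outer face of `H` consists of everything merged with the outer face of `T`. (A removed vertex
merges no faces beyond those merged by its incident edges, which are removed with it.) -/
def outerFace (H : T.graph.Subgraph) : Set T.embedding.Face :=
  {f | Relation.ReflTransGen (T.FaceAdjOff H) T.outer f}

/-- The vertices of `H` whose reflex angle (in `T`) is contained in the outer face of `H`. -/
def corners (H : T.graph.Subgraph) : Set V :=
  {v | v ∈ H.verts ∧ ∃ d ∈ T.reflex, d.fst = v ∧ T.embedding.faceOf d ∈ T.outerFace H}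

end CombinatorialPseudoTriangulation

/-! Let O be the set of faces of `T` inside the outer face of `H`. Keep the edges that lie in `H` or
have a side outside O. Let c be the number of components of the kept graph on all of `V`, B the
number of kept darts on faces of O, and r the number of reflex angles in O. Euler's formula for `T`,
the Euler inequality for the kept graph, pointedness, three convex angles per interior face and
degree at most 4 combine to 2c + B ≤ 2r. A vertex outside `H` with reflex angle in O is an isolated
component, so discarding these vertices lowers c and r equally. With c' the number of components
meeting `H`, this leaves 2c' + B ≤ 2 · (number of corners). It remains to see 2c' + B ≥ 5: either c'
≥ 3, or c' = 2 and B ≥ 1, or c' = 1 and B ≥ 3. -/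

namespace CombinatorialEmbedding

variable {V : Type*} {G : SimpleGraph V} (M : CombinatorialEmbedding G)

theorem facePerm_apply (d : G.Dart) : M.facePerm d = M.rot d.symm := rfl

theorem facePerm_fst (d : G.Dart) : (M.facePerm d).fst = d.snd := by
  rw [facePerm_apply, M.rot_fst]; rfl

theorem faceOf_facePerm (d : G.Dart) : M.faceOf (M.facePerm d) = M.faceOf d :=
  Quotient.sound (s := Equiv.Perm.SameCycle.setoid M.facePerm)
    (Equiv.Perm.sameCycle_apply_left.2 (Equiv.Perm.SameCycle.refl _ _))

theorem faceOf_rot (d : G.Dart) : M.faceOf (M.rot d) = M.faceOf d.symm := by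
  rw [← M.faceOf_facePerm d.symm, facePerm_apply, SimpleGraph.Dart.symm_symm]

theorem exists_faceOf_eq (f : M.Face) : ∃ d, M.faceOf d = f := Quotient.exists_rep f

/-- A property of darts that is inherited by the next dart around the source vertex passes to all
the darts with the same source. -/
theorem forall_of_rot [Finite V] {P : G.Dart → Prop} (h : ∀ d, P d → P (M.rot d)) {d d' : G.Dart}
    (hd : P d) (hdd' : d.fst = d'.fst) : P d' := by
  have : Finite G.Dart :=
    Finite.of_injective SimpleGraph.Dart.toProd SimpleGraph.Dart.toProd_injective
  obtain ⟨n, rfl⟩ := (M.sameCycle d d' hdd').exists_nat_pow_eq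
  clear hdd'
  induction n with
  | zero => simpa using hd
  | succ n ih => rw [pow_succ', Equiv.Perm.mul_apply]; exact h _ ih

/-- Gradients of vertex functions are orthogonal to the boundaries of faces. -/
theorem sum_gradient_mul_face [Fintype G.Dart] (u : V → ℚ) (h : M.Face → ℚ) :
    ∑ d : G.Dart, (u d.fst - u d.snd) * h (M.faceOf d) = 0 := by
  simp only [sub_mul, Finset.sum_sub_distrib]
  rw [sub_eq_zero, ← Equiv.sum_comp M.facePerm]
  simp only [facePerm_fst, faceOf_facePerm]

/-- Reversing darts negates the gradient, so the second term vanishes by the face identity too. This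
holds in any genus. -/
theorem sum_gradient_mul_coboundary [Fintype G.Dart] (u : V → ℚ) (h : M.Face → ℚ) :
    ∑ d : G.Dart, (u d.fst - u d.snd) * (h (M.faceOf d) - h (M.faceOf d.symm)) = 0 := by
  have key := M.sum_gradient_mul_face u h
  have key' : ∑ d : G.Dart, (u d.fst - u d.snd) * h (M.faceOf d.symm) = 0 := by
    rw [← Equiv.sum_comp (Function.Involutive.toPerm SimpleGraph.Dart.symm
      SimpleGraph.Dart.symm_involutive), ← neg_eq_zero, ← Finset.sum_neg_distrib]
    refine Eq.trans (Finset.sum_congr rfl fun d _ => ?_) key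
    simp only [Function.Involutive.coe_toPerm, SimpleGraph.Dart.symm_symm]
    change -((u d.snd - u d.fst) * _) = _
    ring
  simp only [mul_sub, Finset.sum_sub_distrib, key, key', sub_zero]

end CombinatorialEmbedding

theorem ncard_fiberwise_eq {α β : Type*} [Finite α] [Finite β] (f : α → β) (P : α → Prop)
    (S : Set β) (n : ℕ) (h : ∀ b ∈ S, {a | f a = b ∧ P a}.ncard = n) :
    {a | f a ∈ S ∧ P a}.ncard = n * S.ncard := by
  classical
  have := Fintype.ofFinite α
  have := Fintype.ofFinite β
  rw [Set.ncard_eq_toFinset_card', Set.ncard_eq_toFinset_card',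
    Finset.card_eq_sum_card_fiberwise (f := f) (t := S.toFinset) (by intro a; simp +contextual),
    Finset.sum_const_nat (m := n), mul_comm]
  intro b hb
  rw [← h b (by simpa using hb), Set.ncard_eq_toFinset_card']
  congr 1
  ext a
  simp only [Set.mem_toFinset] at hb
  simp only [Finset.mem_filter, Set.mem_toFinset, Set.mem_ofPred_eq]
  grind

theorem ncard_fiberwise_le {α β : Type*} [Finite α] [Finite β] (f : α → β)
    (S : Set β) (n : ℕ) (h : ∀ b ∈ S, {a | f a = b}.ncard ≤ n) :
    {a | f a ∈ S}.ncard ≤ n * S.ncard := by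
  classical
  have := Fintype.ofFinite α
  have := Fintype.ofFinite β
  rw [Set.ncard_eq_toFinset_card', Set.ncard_eq_toFinset_card']
  refine Finset.card_le_mul_card_image_of_maps_to (f := f) (by intro a; simp) n fun b hb => ?_
  refine le_trans (Finset.card_le_card ?_)
    ((Set.ncard_eq_toFinset_card' _).symm.trans_le (h b (by simpa using hb)))
  intro a
  simp

theorem ncard_setOf_and_add {α : Type*} [Finite α] (P Q : α → Prop) :
    {a | P a ∧ Q a}.ncard + {a | P a ∧ ¬ Q a}.ncard = {a | P a}.ncard := by
  rw [← Set.ncard_inter_add_ncard_sdiff_eq_ncard {a | P a} {a | Q a}]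
  rfl

namespace SimpleGraph

variable {V : Type*} {G : SimpleGraph V}

instance [Finite V] : Finite G.Dart :=
  Finite.of_injective Dart.toProd Dart.toProd_injective

theorem natCard_dart [Finite V] : Nat.card G.Dart = 2 * Nat.card G.edgeSet := by
  classical
  have := Fintype.ofFinite V
  rw [Nat.card_eq_fintype_card, Nat.card_eq_fintype_card, dart_card_eq_twice_card_edges,
    edgeFinset_card]

end SimpleGraph

/-! ### The kept region and its components -/

namespace CombinatorialPseudoTriangulation

variable {V : Type*} (T : CombinatorialPseudoTriangulation V) (H : T.graph.Subgraph)

instance [Finite V] : Finite T.embedding.Face := inferInstanceAs (Finite (Quotient _))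

/-- The darts of the closed region formed by `H` and the faces outside the outer face of `H`. -/
def Kept (d : T.graph.Dart) : Prop :=
  d.edge ∈ H.edgeSet ∨ T.embedding.faceOf d ∉ T.outerFace H

/-- The connected components of the graph formed by the kept darts. -/
def KeptComponent : Type _ := Quot fun u v : V => ∃ d, T.Kept H d ∧ d.fst = u ∧ d.snd = v

/-- The component of a vertex. -/
def keptComponent (v : V) : T.KeptComponent H := Quot.mk _ v

instance [Finite V] : Finite (T.KeptComponent H) := inferInstanceAs (Finite (Quot _))

variable {T H}

theorem outer_mem_outerFace : T.outer ∈ T.outerFace H := Relation.ReflTransGen.refl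

theorem faceOf_symm_mem {d : T.graph.Dart} (hd : d.edge ∉ H.edgeSet)
    (h : T.embedding.faceOf d ∈ T.outerFace H) : T.embedding.faceOf d.symm ∈ T.outerFace H :=
  Relation.ReflTransGen.tail h ⟨d, hd, rfl, rfl⟩

theorem not_kept_iff {d : T.graph.Dart} :
    ¬ T.Kept H d ↔ d.edge ∉ H.edgeSet ∧ T.embedding.faceOf d ∈ T.outerFace H := by
  simp [Kept]

theorem Kept.symm {d : T.graph.Dart} (h : T.Kept H d) : T.Kept H d.symm := by
  by_contra hn
  rw [not_kept_iff, SimpleGraph.Dart.edge_symm] at hn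
  have := faceOf_symm_mem (d := d.symm) (by simpa using hn.1) hn.2
  rw [SimpleGraph.Dart.symm_symm] at this
  exact h.elim hn.1 fun h => h this

theorem kept_symm_iff {d : T.graph.Dart} : T.Kept H d.symm ↔ T.Kept H d :=
  ⟨fun h => by simpa using h.symm, Kept.symm⟩

theorem faceOf_rot_mem {d : T.graph.Dart} (h : ¬ T.Kept H d) :
    T.embedding.faceOf (T.embedding.rot d) ∈ T.outerFace H := by
  rw [not_kept_iff] at h
  rw [CombinatorialEmbedding.faceOf_rot]
  exact faceOf_symm_mem h.1 h.2

theorem Kept.keptComponent_eq {d : T.graph.Dart} (h : T.Kept H d) :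
    T.keptComponent H d.fst = T.keptComponent H d.snd :=
  Quot.sound ⟨d, h, rfl, rfl⟩

/-- A property of vertices that is invariant under kept darts is invariant on components. -/
theorem iff_of_keptComponent_eq {P : V → Prop}
    (h : ∀ d, T.Kept H d → P d.fst → P d.snd) {u v : V}
    (huv : T.keptComponent H u = T.keptComponent H v) : P u ↔ P v := by
  have hP : ∀ u v : V, (∃ d, T.Kept H d ∧ d.fst = u ∧ d.snd = v) → P u = P v := by
    rintro _ _ ⟨d, hd, rfl, rfl⟩
    exact propext ⟨h d hd, h d.symm hd.symm⟩
  exact iff_of_eq (congrArg (Quot.lift P hP) huv)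

theorem forall_of_adj {P : V → Prop} (h : ∀ d : T.graph.Dart, P d.fst → P d.snd) {u : V}
    (hu : P u) (v : V) : P v := by
  obtain ⟨w⟩ := T.connected.preconnected u v
  induction w with
  | nil => exact hu
  | cons hadj _ ih => exact ih (h ⟨(_, _), hadj⟩ hu)

/-! ### Euler's inequality for the kept region -/

/-- The linear-algebraic half of Euler's formula for the closed region. -/
theorem card_keptComponent_add_le [Finite V] (e : V → ℕ) (he : Function.Injective e) :
    Nat.card (T.KeptComponent H) + (T.outerFace H).ncard ≤
      {d | ¬ T.Kept H d ∧ e d.fst < e d.snd}.ncard + 2 := by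
  classical
  have := Fintype.ofFinite T.graph.Dart
  have := Fintype.ofFinite (T.KeptComponent H)
  have := Fintype.ofFinite (T.outerFace H)
  -- The injection `e` selects one dart from each non-kept edge.
  let S := {d | ¬ T.Kept H d ∧ e d.fst < e d.snd}
  let v₀ : V := T.connected.nonempty.some
  let ext : (T.outerFace H → ℚ) →ₗ[ℚ] (T.embedding.Face → ℚ) :=
    { toFun := fun h f => if hf : f ∈ T.outerFace H then h ⟨f, hf⟩ else 0
      map_add' := by intro a b; ext f; by_cases hf : f ∈ T.outerFace H <;> simp [hf]
      map_smul' := by intro a b; ext f; by_cases hf : f ∈ T.outerFace H <;> simp [hf] }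
  let val : (T.KeptComponent H → ℚ) × (T.outerFace H → ℚ) → T.graph.Dart → ℚ := fun p d =>
    (p.1 (T.keptComponent H d.fst) - p.1 (T.keptComponent H d.snd)) +
      (ext p.2 (T.embedding.faceOf d) - ext p.2 (T.embedding.faceOf d.symm))
  -- The last two coordinates normalize the additive constants of the two potentials; they account
  -- for the `+ 2`.
  let L : ((T.KeptComponent H → ℚ) × (T.outerFace H → ℚ)) →ₗ[ℚ] (S → ℚ) × ℚ × ℚ :=
    { toFun := fun p => (fun d => val p d, p.1 (T.keptComponent H v₀), ext p.2 T.outer)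
      map_add' := by
        intro p q
        refine Prod.ext (funext fun d => ?_) (Prod.ext ?_ ?_)
        · simp only [val, Prod.fst_add, Prod.snd_add, Pi.add_apply, map_add]; ring
        · simp
        · simp
      map_smul' := by
        intro c p
        refine Prod.ext (funext fun d => ?_) (Prod.ext ?_ ?_)
        · simp only [val, Prod.smul_fst, Prod.smul_snd, Pi.smul_apply, map_smul, smul_eq_mul,
            RingHom.id_apply]
          ring
        · simp
        · simp }
  have hL : Function.Injective L := by
    rw [← LinearMap.ker_eq_bot, LinearMap.ker_eq_bot']
    rintro ⟨u, h⟩ h0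
    have hval : ∀ d, ¬ T.Kept H d → val (u, h) d = 0 := by
      intro d hd
      rcases lt_trichotomy (e d.fst) (e d.snd) with hlt | heq | hgt
      · exact congrFun (congrArg Prod.fst h0) ⟨d, hd, hlt⟩
      · exact absurd (he heq) d.adj.ne
      · have := congrFun (congrArg Prod.fst h0) ⟨d.symm, by rwa [kept_symm_iff], hgt⟩
        change val (u, h) d.symm = 0 at this
        simp only [val, SimpleGraph.Dart.symm_symm] at this ⊢
        change (u (T.keptComponent H d.snd) - u (T.keptComponent H d.fst)) + _ = 0 at this
        linarith
    have hu0 : u (T.keptComponent H v₀) = 0 := congrArg (fun x => x.2.1) h0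
    have hh0 : ext h T.outer = 0 := congrArg (fun x => x.2.2) h0
    have horth := T.embedding.sum_gradient_mul_coboundary
      (fun v => u (T.keptComponent H v)) (ext h)
    -- On kept darts the gradient of `u` vanishes; on the others it is minus the coboundary of `h`.
    -- Orthogonality thus makes its squared norm zero.
    have hsq : ∑ d : T.graph.Dart,
        (u (T.keptComponent H d.fst) - u (T.keptComponent H d.snd)) ^ 2 = 0 := by
      rw [← neg_eq_zero, ← Finset.sum_neg_distrib]
      refine Eq.trans (Finset.sum_congr rfl fun d _ => ?_) horth
      by_cases hd : T.Kept H d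
      · simp [hd.keptComponent_eq]
      · have := hval d hd
        simp only [val] at this
        rw [eq_neg_of_add_eq_zero_right this]
        ring
    have hgrad : ∀ d : T.graph.Dart,
        u (T.keptComponent H d.fst) = u (T.keptComponent H d.snd) := by
      intro d
      rw [Finset.sum_eq_zero_iff_of_nonneg fun _ _ => sq_nonneg _] at hsq
      exact sub_eq_zero.1 (pow_eq_zero_iff two_ne_zero |>.1 (hsq d (Finset.mem_univ d)))
    have hu : ∀ v, u (T.keptComponent H v) = 0 :=
      forall_of_adj (fun d hd => (hgrad d).symm.trans hd) hu0
    have hh : ∀ f ∈ T.outerFace H, ext h f = 0 := by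
      intro f hf
      induction hf with
      | refl => exact hh0
      | tail hf hadj ih =>
        obtain ⟨d, hd, rfl, rfl⟩ := hadj
        have := hval d (not_kept_iff.2 ⟨hd, hf⟩)
        simp only [val, hgrad d, ih] at this
        linarith
    refine Prod.ext (funext fun c => ?_) (funext fun f => ?_)
    · obtain ⟨v, rfl⟩ := Quot.exists_rep c
      exact hu v
    · have := hh f f.2
      simpa [ext] using this
  have := LinearMap.finrank_le_finrank_of_injective hL
  rw [Module.finrank_prod, Module.finrank_prod, Module.finrank_prod,
    Module.finrank_fintype_fun_eq_card, Module.finrank_fintype_fun_eq_card, Module.finrank_fintype_fun_eq_card, Module.finrank_self,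
    ← Nat.card_eq_fintype_card, ← Nat.card_eq_fintype_card, ← Nat.card_eq_fintype_card,
    Nat.card_coe_set_eq, Nat.card_coe_set_eq] at this
  exact this

theorem two_mul_card_keptComponent_add_le [Finite V] :
    2 * Nat.card (T.KeptComponent H) + 2 * (T.outerFace H).ncard ≤
      {d | ¬ T.Kept H d}.ncard + 4 := by
  obtain ⟨n, ⟨i⟩⟩ := Finite.exists_equiv_fin V
  let e : V → ℕ := fun v => i v
  have he : Function.Injective e := Fin.val_injective.comp i.injective
  have h1 := card_keptComponent_add_le (T := T) (H := H) e he
  have h2 := ncard_setOf_and_add (fun d => ¬ T.Kept H d) (fun d => e d.fst < e d.snd)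
  have h3 : {d | ¬ T.Kept H d ∧ e d.fst < e d.snd}.ncard ≤
      {d | ¬ T.Kept H d ∧ ¬ e d.fst < e d.snd}.ncard :=
    Set.ncard_le_ncard_of_injOn SimpleGraph.Dart.symm
      (fun d hd => ⟨by rw [kept_symm_iff]; exact hd.1, not_lt_of_gt hd.2⟩)
      SimpleGraph.Dart.symm_involutive.injective.injOn
  omega

/-! ### Counting reflex angles -/

theorem ncard_reflex [Finite V] (hT : T.IsFourPPT) : T.reflex.ncard = Nat.card V := by
  rw [← Set.ncard_univ, ← Set.InjOn.ncard_image (f := fun d : T.graph.Dart => d.fst)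
    (s := T.reflex) fun d hd d' hd' h => T.reflex_unique d hd d' hd' h]
  congr 1
  exact Set.eq_univ_of_forall hT.pointed

/-- Let F' faces with D' darts lie outside O. Euler bounds the left side by 2|V| + 2F' - D'. The
right side is 2(|V| - (D' - 3F')), larger by 4F' - D' ≥ 0; the degree bound enters only here. -/
theorem two_mul_card_keptComponent_add_boundary_le [Finite V] (hT : T.IsFourPPT) :
    2 * Nat.card (T.KeptComponent H) +
      {d | T.Kept H d ∧ T.embedding.faceOf d ∈ T.outerFace H}.ncard ≤
      2 * {d | d ∈ T.reflex ∧ T.embedding.faceOf d ∈ T.outerFace H}.ncard := by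
  have hne : ∀ f ∈ (T.outerFace H)ᶜ, f ≠ T.outer := by
    rintro f hf rfl; exact hf outer_mem_outerFace
  have hconv := ncard_fiberwise_eq T.embedding.faceOf (fun d => d ∉ T.reflex) (T.outerFace H)ᶜ 3
    fun f hf => T.three_convex f (hne f hf)
  have hdeg := ncard_fiberwise_le T.embedding.faceOf (T.outerFace H)ᶜ 4
    fun f hf => hT.degree_le f (hne f hf)
  have hfaces := Set.ncard_add_ncard_compl (T.outerFace H)
  have hin := ncard_setOf_and_add (fun d => T.embedding.faceOf d ∈ (T.outerFace H)ᶜ)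
    (fun d => d ∈ T.reflex)
  have hrefl := ncard_setOf_and_add (fun d => d ∈ T.reflex)
    (fun d => T.embedding.faceOf d ∈ T.outerFace H)
  have hcomm : {d | d ∈ T.reflex ∧ T.embedding.faceOf d ∉ T.outerFace H} =
      {d | T.embedding.faceOf d ∈ (T.outerFace H)ᶜ ∧ d ∈ T.reflex} := by
    ext d; exact and_comm
  have hkept := ncard_setOf_and_add (fun d => T.Kept H d)
    (fun d => T.embedding.faceOf d ∈ T.outerFace H)
  have hkept' : {d | T.Kept H d ∧ T.embedding.faceOf d ∉ T.outerFace H} =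
      {d | T.embedding.faceOf d ∈ (T.outerFace H)ᶜ} := by
    ext d; exact ⟨fun h => h.2, fun h => ⟨Or.inr h, h⟩⟩
  have hdarts := Set.ncard_add_ncard_compl {d | T.Kept H d}
  have hcompl : {d | T.Kept H d}ᶜ = {d | ¬ T.Kept H d} := rfl
  have hedges := SimpleGraph.natCard_dart (G := T.graph)
  have hreflV := ncard_reflex hT
  have hset : {d | d ∈ T.reflex} = T.reflex := rfl
  have heuler : _ = _ := T.planar
  have hlin := two_mul_card_keptComponent_add_le (T := T) (H := H)
  rw [hcomm, hset] at hrefl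
  rw [hkept'] at hkept
  rw [hcompl] at hdarts
  omega

/-- No edge at `v` is in `H`, so turning around `v` from an angle in O never leaves O. -/
theorem not_kept_of_reflex [Finite V] {v : V} (hv : v ∉ H.verts) {d : T.graph.Dart}
    (hd : d.fst = v) (hO : T.embedding.faceOf d ∈ T.outerFace H) {d' : T.graph.Dart}
    (hd' : d'.fst = v) : ¬ T.Kept H d' := by
  have hedge : ∀ d : T.graph.Dart, d.fst = v → d.edge ∉ H.edgeSet := by
    rintro d rfl h
    exact hv (H.edge_vert (v := d.fst) (w := d.snd) h)
  refine (T.embedding.forall_of_rot (P := fun d => d.fst = v ∧ ¬ T.Kept H d) ?_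
    ⟨hd, not_kept_iff.2 ⟨hedge d hd, hO⟩⟩ (hd.trans hd'.symm)).2
  rintro d ⟨h1, h2⟩
  have h3 := (T.embedding.rot_fst d).trans h1
  exact ⟨h3, not_kept_iff.2 ⟨hedge _ h3, faceOf_rot_mem h2⟩⟩

/-- The number of corners is bounded below in terms of the number of components meeting `H` and the length of
the boundary of the outer face. -/
theorem two_mul_ncard_components_add_boundary_le [Finite V] (hT : T.IsFourPPT) :
    2 * (T.keptComponent H '' H.verts).ncard +
      {d | T.Kept H d ∧ T.embedding.faceOf d ∈ T.outerFace H}.ncard ≤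
      2 * (T.corners H).ncard := by
  let X : Set V := {v | v ∉ H.verts ∧ ∃ d ∈ T.reflex, d.fst = v ∧
    T.embedding.faceOf d ∈ T.outerFace H}
  have hX : ∀ x ∈ X, ∀ v, T.keptComponent H x = T.keptComponent H v → x = v := by
    rintro x ⟨hx, d, -, hd, hO⟩ v hv
    refine ((iff_of_keptComponent_eq (P := fun y => x = y) ?_ hv).1 rfl)
    rintro d' hd' h
    exact absurd hd' (not_kept_of_reflex hx hd hO h.symm)
  have hXcard : (T.keptComponent H '' X).ncard = X.ncard :=
    Set.InjOn.ncard_image fun x hx y _ h => hX x hx y h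
  have hdisj : Disjoint (T.keptComponent H '' H.verts) (T.keptComponent H '' X) := by
    rw [Set.disjoint_left]
    rintro _ ⟨v, hv, rfl⟩ ⟨x, hx, h⟩
    exact hx.1 (hX x hx v h ▸ hv)
  have hle : (T.keptComponent H '' H.verts).ncard + (T.keptComponent H '' X).ncard ≤
      Nat.card (T.KeptComponent H) := by
    rw [← Set.ncard_union_eq hdisj, ← Set.ncard_univ]
    exact Set.ncard_le_ncard (Set.subset_univ _)
  have hr : {d | d ∈ T.reflex ∧ T.embedding.faceOf d ∈ T.outerFace H}.ncard ≤
      (T.corners H).ncard + X.ncard := by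
    refine le_trans ?_ (Set.ncard_union_le _ _)
    refine Set.ncard_le_ncard_of_injOn (fun d => d.fst) ?_
      fun d hd d' hd' h => T.reflex_unique d hd.1 d' hd'.1 h
    rintro d ⟨hd, hO⟩
    by_cases hv : d.fst ∈ H.verts
    · exact Or.inl ⟨hv, d, hd, rfl, hO⟩
    · exact Or.inr ⟨hv, d, hd, rfl, hO⟩
  have := two_mul_card_keptComponent_add_boundary_le (H := H) hT
  omega

/-! ### Boundary of the outer face -/

/-- Every component with a kept dart has a dart on the boundary of the outer face. -/
theorem exists_boundary_dart [Finite V] {d : T.graph.Dart} (hd : T.Kept H d) :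
    ∃ d', (T.Kept H d' ∧ T.embedding.faceOf d' ∈ T.outerFace H) ∧
      T.keptComponent H d'.fst = T.keptComponent H d.fst := by
  by_contra! hno
  -- Without a boundary dart, every face around a vertex of the component avoids O. All edges there
  -- are then kept, and connectivity of `T` spreads this to `T.outer`.
  have hstar : ∀ v, (T.keptComponent H v = T.keptComponent H d.fst ∧
      ∃ c : T.graph.Dart, c.fst = v ∧ T.Kept H c) → ∀ c : T.graph.Dart, c.fst = v →
      T.embedding.faceOf c ∉ T.outerFace H := by
    rintro v ⟨hv, c, hc, hck⟩ c' hc'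
    refine (T.embedding.forall_of_rot (P := fun c => c.fst = v ∧
      T.embedding.faceOf c ∉ T.outerFace H) ?_ ⟨hc, fun h => hno c ⟨hck, h⟩ (hc ▸ hv)⟩
      (hc.trans hc'.symm)).2
    rintro c ⟨rfl, h⟩
    refine ⟨T.embedding.rot_fst c, ?_⟩
    have hk : T.Kept H c := Or.inr h
    rw [CombinatorialEmbedding.faceOf_rot]
    exact fun h' => hno c.symm ⟨hk.symm, h'⟩ (hk.keptComponent_eq.symm.trans hv)
  have hall := forall_of_adj (T := T) (P := fun v =>
    T.keptComponent H v = T.keptComponent H d.fst ∧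
      ∃ c : T.graph.Dart, c.fst = v ∧ T.Kept H c) (fun c hc => by
        have hk : T.Kept H c := Or.inr (hstar _ hc c rfl)
        exact ⟨hk.keptComponent_eq.symm.trans hc.1, c.symm, rfl, hk.symm⟩)
    (u := d.fst) ⟨rfl, d, rfl, hd⟩
  obtain ⟨c, hc⟩ := T.embedding.exists_faceOf_eq T.outer
  exact hstar _ (hall c.fst) c rfl (hc ▸ outer_mem_outerFace)

/-- The boundary walk of the outer face of `H` continues at the end of a boundary dart without
turning back, unless that dart ends at a leaf. -/
theorem exists_boundary_dart_next [Finite V] {d : T.graph.Dart}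
    (hO : T.embedding.faceOf d ∈ T.outerFace H) :
    (∃ c, (T.Kept H c ∧ T.embedding.faceOf c ∈ T.outerFace H) ∧ c.fst = d.snd ∧ c ≠ d.symm) ∨
      T.embedding.faceOf d.symm ∈ T.outerFace H ∧
        ∀ c, T.Kept H c → c.fst = d.snd → c = d.symm := by
  rw [or_iff_not_imp_left]
  intro hno
  push Not at hno
  have hface : T.embedding.faceOf (T.embedding.rot d.symm) ∈ T.outerFace H := by
    rwa [CombinatorialEmbedding.faceOf_rot, SimpleGraph.Dart.symm_symm]
  -- Turning around `d.snd` from `d.symm` stays in O: every dart crossed is non-kept or is `d.symm`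
  -- itself.
  have hP : ∀ c : T.graph.Dart, c.fst = d.snd → c.fst = d.snd ∧
      T.embedding.faceOf (T.embedding.rot c) ∈ T.outerFace H ∧ (c = d.symm ∨ ¬ T.Kept H c) := by
    intro c hcd
    refine T.embedding.forall_of_rot (P := fun x => x.fst = d.snd ∧
      T.embedding.faceOf (T.embedding.rot x) ∈ T.outerFace H ∧ (x = d.symm ∨ ¬ T.Kept H x)) ?_
      (d := d.symm) ⟨rfl, hface, Or.inl rfl⟩ hcd.symm
    rintro x ⟨hx, hxO, -⟩
    have hfst := (T.embedding.rot_fst x).trans hx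
    refine ⟨hfst, ?_⟩
    by_cases hk : T.Kept H (T.embedding.rot x)
    · have := hno _ ⟨hk, hxO⟩ hfst
      rw [this]
      exact ⟨hface, Or.inl rfl⟩
    · exact ⟨faceOf_rot_mem hk, Or.inr hk⟩
  refine ⟨?_, fun c hc hcd => (hP c hcd).2.2.resolve_right fun h => h hc⟩
  have := (hP (T.embedding.rot.symm d.symm)
    (by rw [← T.embedding.rot_fst, Equiv.apply_symm_apply]; rfl)).2.1
  rwa [Equiv.apply_symm_apply] at this

theorem exists_kept_dart_of_keptComponent_eq {u v : V} (huv : u ≠ v)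
    (h : T.keptComponent H u = T.keptComponent H v) : ∃ d, T.Kept H d ∧ d.fst = u := by
  by_contra! hno
  refine huv ((iff_of_keptComponent_eq (P := fun y => u = y) ?_ h).1 rfl)
  rintro d hd h'
  exact absurd h'.symm (hno d hd)

/-- A component with at least three vertices has at least three boundary darts. -/
theorem three_le_ncard_boundary [Finite V] {d : T.graph.Dart} (hd : T.Kept H d)
    (hO : T.embedding.faceOf d ∈ T.outerFace H)
    (hS : 3 ≤ {v | T.keptComponent H d.fst = T.keptComponent H v}.ncard) :
    3 ≤ {d | T.Kept H d ∧ T.embedding.faceOf d ∈ T.outerFace H}.ncard := by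
  by_contra! hlt
  have hthree : ∀ a b c : T.graph.Dart, (T.Kept H a ∧ T.embedding.faceOf a ∈ T.outerFace H) →
      (T.Kept H b ∧ T.embedding.faceOf b ∈ T.outerFace H) →
      (T.Kept H c ∧ T.embedding.faceOf c ∈ T.outerFace H) → a ≠ b → a ≠ c → b ≠ c → False := by
    intro a b c ha hb hc hab hac hbc
    refine absurd hlt (not_lt.2 ((Set.two_lt_ncard_iff (Set.toFinite _)).2
      ⟨a, b, c, ha, hb, hc, hab, hac, hbc⟩))
  have hne : ∀ a b : T.graph.Dart, b.fst = a.snd → a ≠ b := by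
    rintro a _ h rfl
    exact a.adj.ne h
  rcases exists_boundary_dart_next hO with ⟨c, hc, hcd, hcne⟩ | ⟨hO', hleaf⟩
  · have hdc : d ≠ c.symm := fun h => hcne (by rw [h, SimpleGraph.Dart.symm_symm])
    rcases exists_boundary_dart_next hc.2 with ⟨e, he, hec, hene⟩ | ⟨hcO, -⟩
    · refine hthree d c e ⟨hd, hO⟩ hc he (hne d c hcd) ?_ (hne c e hec)
      rintro rfl
      exact hcne (SimpleGraph.Dart.ext _ _ (Prod.ext hcd hec.symm))
    · exact hthree d c c.symm ⟨hd, hO⟩ hc ⟨hc.1.symm, hcO⟩ (hne d c hcd) hdc (hne c c.symm rfl)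
  · rcases exists_boundary_dart_next hO' with ⟨c, hc, hcd, hcne⟩ | ⟨-, hleaf'⟩
    · rw [SimpleGraph.Dart.symm_symm] at hcne
      exact hthree d d.symm c ⟨hd, hO⟩ ⟨hd.symm, hO'⟩ hc (hne d d.symm rfl) hcne.symm
        (hne d.symm c hcd)
    -- Both ends are leaves, so the component is a single edge with only two vertices.
    · rw [SimpleGraph.Dart.symm_symm] at hleaf'
      refine absurd ((hS.trans (Set.ncard_le_ncard (t := {d.fst, d.snd}) ?_)).trans
        (Set.ncard_pair d.adj.ne).le) (by norm_num)
      intro v hv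
      refine (iff_of_keptComponent_eq (P := fun v => v ∈ ({d.fst, d.snd} : Set V)) ?_ hv).1
        (Or.inl rfl)
      rintro c hc (h | h)
      · rw [hleaf' c hc h]; exact Or.inr rfl
      · rw [hleaf c hc h]; exact Or.inl rfl

end CombinatorialPseudoTriangulation

theorem mainTheorem7 {V : Type*} [Finite V] (T : CombinatorialPseudoTriangulation V)
    (hT : T.IsFourPPT) (H : T.graph.Subgraph) (hH : 3 ≤ H.verts.ncard) :
    3 ≤ (T.corners H).ncard := by
  open CombinatorialPseudoTriangulation in
  have hmain := two_mul_ncard_components_add_boundary_le (H := H) hT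
  have hpos : 0 < (T.keptComponent H '' H.verts).ncard := by
    rw [Set.ncard_pos (Set.toFinite _)]
    exact (Set.nonempty_of_ncard_ne_zero (by omega)).image _
  by_cases hinj : Set.InjOn (T.keptComponent H) H.verts
  · rw [Set.InjOn.ncard_image hinj] at hmain
    omega
  · simp only [Set.InjOn, not_forall] at hinj
    obtain ⟨u, hu, v, hv, huv, hne⟩ := hinj
    obtain ⟨d, hd, hdu⟩ := exists_kept_dart_of_keptComponent_eq hne huv
    obtain ⟨d', hd', hcomp⟩ := exists_boundary_dart hd
    have hB : 0 < {d | T.Kept H d ∧ T.embedding.faceOf d ∈ T.outerFace H}.ncard :=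
      (Set.ncard_pos (Set.toFinite _)).2 ⟨d', hd'⟩
    -- A single component contains all of `H.verts`, giving 2 + 3 ≥ 5; otherwise 4 + 1 ≥ 5.
    by_cases hone : (T.keptComponent H '' H.verts).ncard = 1
    · have := three_le_ncard_boundary hd'.1 hd'.2 (hH.trans (Set.ncard_le_ncard (by
        obtain ⟨c, hc⟩ := Set.ncard_eq_one.1 hone
        have hall : ∀ w ∈ H.verts, T.keptComponent H w = c := fun w hw =>
          Set.mem_singleton_iff.1 (hc ▸ Set.mem_image_of_mem _ hw)
        intro w hw
        exact hcomp.trans ((hdu ▸ hall u hu).trans (hall w hw).symm))))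
      omega
    · omega
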